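/- Let $m\le n$ and let $M$ be a smooth, compact, orientable manifold of dimension $m$, possibly with boundary, with a fixed volume form $\mu$. *The space of full-ranked one-forms.* Let $\Omega^1(M,\mathbb R^n)$ be the space of smooth $\mathbb R^n$-valued one-forms on $M$ with its Fréchet ($C^\infty$) topology, and let $\Omega^1_+(M,\mathbb R^n)$ be its open subset of full-ranked one-forms, i.e. those $\alpha$ for which $\alpha(x):T_xM\to\mathbb R^n$ is injective for all $x\in M$. The generalized Ebin metric on $\Omega^1_+(M,\mathbb R^n)$ is $$G_\alpha(\zeta,\eta)=\int_M \operatorname{tr}\big(\zeta_x(\alpha_x^T\alpha_x)^{-1}\eta_x^T\big)\,\operatorname{vol}(\alpha),\qquad \zeta,\eta\in\Omega^1(M,\mathbb R^n),$$ where $\operatorname{vol}(\alpha)$ is the volume density of the Riemannian metric $\alpha^T\alpha$ on $M$ and the integrand is computed in an arbitrary basis of $T_xM$. Its geodesic distance is $$\operatorname{dist}^{\Omega^1_+}(\alpha,\beta)=\inf_\gamma\int_0^1\sqrt{G_{\gamma(t)}(\gamma'(t),\gamma'(t))}\,dt\in[0,\infty],$$ the infimum being over all piecewise $C^1$ curves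 $\gamma:[0,1]\to\Omega^1_+(M,\mathbb R^n)$ from $\alpha$ to $\beta$ (it is $\infty$ if there is no such curve). *The space of full-rank matrices.* Let $M_+(n,m)$ be the space of real $n\times m$ matrices of rank $m$, with the Riemannian metric $\langle u,v\rangle_a=\operatorname{tr}\big(u(a^Ta)^{-1}v^T\big)\sqrt{\det(a^Ta)}$, and let $\operatorname{dist}^{n\times m}:M_+(n,m)\times M_+(n,m)\to[0,\infty]$ be its geodesic distance, defined in the same way with piecewise $C^1$ curves in $M_+(n,m)$. **Theorem.** The geodesic distance $\operatorname{dist}^{\Omega^1_+}$ is non-degenerate: for $\alpha,\beta\in\Omega^1_+(M,\mathbb R^n)$ one has $\operatorname{dist}^{\Omega^1_+}(\alpha,\beta)=0$ if and only if $\alpha=\beta$. Moreover, for all $\alpha,\beta\in\Omega^1_+(M,\mathbb R^n)$, $$\operatorname{dist}^{\Omega^1_+}(\alpha,\beta)^2\ \ge\ \int_M \operatorname{dist}^{n\times m}\big(\alpha(x),\beta(x)\big)^2\,\mu ,$$ where, for each $x\in M$, $\alpha(x)$ and $\beta(x)$ are written as $n\times m$ matrices in one and the same, arbitrary, basis of $T_xM$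 of unit volume with respect to $\mu$. -/

import Mathlib

open Set Filter Topology MeasureTheory Manifold Bundle
open scoped ENNReal Matrix ContDiff

noncomputable section

namespace GeneralizedEbin

/-! ### Curves and geodesic distance in an open subset of a topological vector space -/

/-- `γ : [0,1] → V` is piecewise continuously differentiable with velocity `γ'`: there is a
partition `0 = t 0 ≤ t 1 ≤ … ≤ t k = 1` such that on each closed piece `γ` is differentiable
(one-sidedly at the end points) with a continuous derivative `g`, and `γ' = g` inside the piece.
The values of `γ'` at the break points are irrelevant. -/
def IsPiecewiseC1 {V : Type*} [AddCommGroup V] [Module ℝ V] [TopologicalSpace V]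
    (γ γ' : ℝ → V) : Prop :=
  ∃ (k : ℕ) (t : ℕ → ℝ), Monotone t ∧ t 0 = 0 ∧ t k = 1 ∧
    ∀ i < k, ∃ g : ℝ → V,
      ContinuousOn g (Icc (t i) (t (i + 1))) ∧
      (∀ s ∈ Icc (t i) (t (i + 1)),
        Tendsto (slope γ s) (𝓝[Icc (t i) (t (i + 1)) \ {s}] s) (𝓝 (g s))) ∧
      EqOn γ' g (Ioo (t i) (t (i + 1)))

/-- The geodesic (pseudo) distance on a set `U ⊆ V` of a family of inner products
`g p : V × V → ℝ`, `p ∈ U`: the infimum of the lengths `∫₀¹ √(g_γ(γ', γ')) dt` of the piecewise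
`C¹` curves in `U` from `p` to `q`. It is `∞` if there is no such curve. -/
def geodesicDist {V : Type*} [AddCommGroup V] [Module ℝ V] [TopologicalSpace V]
    (U : Set V) (g : V → V → V → ℝ) (p q : V) : ℝ≥0∞ :=
  ⨅ (γ : ℝ → V) (γ' : ℝ → V) (_ : IsPiecewiseC1 γ γ') (_ : ∀ s ∈ Icc (0 : ℝ) 1, γ s ∈ U)
    (_ : γ 0 = p) (_ : γ 1 = q),
    ∫⁻ s in Icc (0 : ℝ) 1, ENNReal.ofReal (√(g (γ s) (γ' s) (γ' s)))

/-! ### Full rank matrices -/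

/-- The space `M₊(n,m)` of `n × m` matrices of rank `m`. -/
def fullRankMatrices (n m : ℕ) : Set (Matrix (Fin n) (Fin m) ℝ) :=
  {a | a.rank = m}

/-- `tr (u (aᵀa)⁻¹ vᵀ)`. -/
def traceForm {n m : ℕ} (a u v : Matrix (Fin n) (Fin m) ℝ) : ℝ :=
  (u * (aᵀ * a)⁻¹ * vᵀ).trace

/-- The Riemannian metric `⟨u, v⟩_a = tr (u (aᵀa)⁻¹ vᵀ) √det(aᵀa)` on `M₊(n,m)`. -/
def matrixMetric {n m : ℕ} (a u v : Matrix (Fin n) (Fin m) ℝ) : ℝ :=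
  traceForm a u v * √((aᵀ * a).det)

/-- The geodesic distance `dist^{n×m}` on `M₊(n,m)`. -/
def matrixDist {n m : ℕ} (a b : Matrix (Fin n) (Fin m) ℝ) : ℝ≥0∞ :=
  geodesicDist (fullRankMatrices n m) matrixMetric a b

/-! ### One-forms -/

section Manifold

variable {m : ℕ} {H : Type*} [TopologicalSpace H]
  (I : ModelWithCorners ℝ (EuclideanSpace ℝ (Fin m)) H)
  (M : Type*) [TopologicalSpace M] [ChartedSpace H M] [IsManifold I ∞ M]

/-- `Ω¹(M, ℝⁿ)`: smooth `ℝⁿ`-valued one-forms, i.e. smooth sections of the bundle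
`Hom(TM, ℝⁿ)`. -/
abbrev OneForm (n : ℕ) : Type _ :=
  Cₛ^∞⟮I; EuclideanSpace ℝ (Fin m) →L[ℝ] EuclideanSpace ℝ (Fin n),
    fun x : M => TangentSpace I x →L[ℝ] Bundle.Trivial M (EuclideanSpace ℝ (Fin n)) x⟯

instance oneFormAddCommGroup (n : ℕ) : AddCommGroup (OneForm I M n) :=
  ContMDiffSection.instAddCommGroup

instance oneFormModule (n : ℕ) : Module ℝ (OneForm I M n) :=
  ContMDiffSection.instModule

variable {M}

/-- The coordinate vectors `∂₁, …, ∂ₘ` at the point `x` of the chart around `c`. -/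
def coordFrame (c x : M) (j : Fin m) : TangentSpace I x :=
  (trivializationAt (EuclideanSpace ℝ (Fin m)) (TangentSpace I) c).symmL ℝ x
    (EuclideanSpace.single j (1 : ℝ))

variable {I}

/-- The matrix of a linear map `a : TₓM → ℝⁿ` in a frame `e₁, …, eₘ` of `TₓM`: its `j`-th column
is `a (eⱼ)`. -/
def frameMatrix {n : ℕ} {x : M}
    (a : TangentSpace I x →L[ℝ] Bundle.Trivial M (EuclideanSpace ℝ (Fin n)) x)
    (e : Fin m → TangentSpace I x) : Matrix (Fin n) (Fin m) ℝ :=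
  Matrix.of fun i j => (show EuclideanSpace ℝ (Fin n) from a (e j)) i

/-- The coefficients `(α(∂₁), …, α(∂ₘ))` of a one-form in the chart around `c`, as a function on
the image of that chart. -/
def coordRep {n : ℕ} (c : M) (α : OneForm I M n) (y : EuclideanSpace ℝ (Fin m)) :
    Fin m → EuclideanSpace ℝ (Fin n) :=
  fun j => α ((extChartAt I c).symm y) (coordFrame I c ((extChartAt I c).symm y) j)

/-- The Fréchet (`C^∞`) topology on `Ω¹(M, ℝⁿ)`: uniform convergence of the partial derivatives of
every order `k` of the coefficients, in every chart, on every compact subset of the image of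
the chart. -/
instance oneFormTopology (n : ℕ) : TopologicalSpace (OneForm I M n) :=
  ⨅ (c : M) (k : ℕ), TopologicalSpace.induced
    (fun α : OneForm I M n =>
      UniformOnFun.ofFun {K : Set (EuclideanSpace ℝ (Fin m)) |
          IsCompact K ∧ K ⊆ (extChartAt I c).target}
        (iteratedFDerivWithin ℝ k (coordRep c α) (extChartAt I c).target))
    inferInstance

variable (I M)

/-- `Ω¹₊(M, ℝⁿ)`: the one-forms `α` such that `α(x)` is injective for every `x`. -/
def fullRankOneForms (n : ℕ) : Set (OneForm I M n) :=
  {α | ∀ x : M, Function.Injective (α x)}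

/-! ### Volume forms and integration of densities -/

/-- A volume form: a smooth nowhere vanishing `m`-form on the `m`-dimensional manifold `M`.
(Such a form exists if and only if `M` is orientable.) Smoothness is that of its coefficient
`μ(∂₁, …, ∂ₘ)` in every chart. -/
structure VolumeForm where
  /-- the alternating form on each tangent space -/
  toFun : ∀ x : M, TangentSpace I x [⋀^Fin m]→L[ℝ] ℝ
  smooth' : ∀ c : M, ContMDiffOn I 𝓘(ℝ, ℝ) ∞ (fun x => toFun x (coordFrame I c x))
    (chartAt H c).source
  ne_zero' : ∀ x : M, toFun x ≠ 0

variable [T2Space M] [CompactSpace M]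

/-- A smooth partition of unity subordinate to the atlas. -/
def chartPartition : SmoothPartitionOfUnity M I M univ :=
  Classical.choose (SmoothPartitionOfUnity.exists_isSubordinate_chartAt_source I M)

theorem chartPartition_isSubordinate :
    (chartPartition I M).IsSubordinate (fun c => (chartAt H c).source) :=
  Classical.choose_spec (SmoothPartitionOfUnity.exists_isSubordinate_chartAt_source I M)

variable {I M} [MeasurableSpace M]

/-- The measure of integration against a density `D`, given as a function on frames
(with `D x (e · A) = |det A| D x e`):
`∫_M f D = ∑_c ∫ (ρ_c f)(x(y)) D(∂₁, …, ∂ₘ) dy`, with `ρ` a partition of unity subordinate to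
the charts and `dy` the Lebesgue measure on the image of the chart around `c`. -/
def densityMeasure (D : ∀ x : M, (Fin m → TangentSpace I x) → ℝ) : Measure M :=
  Measure.sum fun c : M =>
    Measure.map (extChartAt I c).symm
      ((volume.restrict (extChartAt I c).target).withDensity fun y =>
        ENNReal.ofReal (chartPartition I M c ((extChartAt I c).symm y)) *
        ENNReal.ofReal (D ((extChartAt I c).symm y)
          (coordFrame I c ((extChartAt I c).symm y))))

/-- The measure on `M` given by integration against a volume form `μ` (with `M` oriented
by `μ`). -/
def VolumeForm.measure (μ : VolumeForm I M) : Measure M :=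
  densityMeasure fun x e => |μ.toFun x e|

/-- The volume measure `vol(α)` of the Riemannian metric `αᵀα` on `M`. -/
def oneFormVolume {n : ℕ} (α : OneForm I M n) : Measure M :=
  densityMeasure fun x e => √(((frameMatrix (α x) e)ᵀ * frameMatrix (α x) e).det)

/-! ### The generalized Ebin metric -/

/-- The generalized Ebin metric `G_α(ζ, η) = ∫_M (αᵀα)⁻¹(ζ, η) vol(α)`. The inner product
`(αᵀα)⁻¹(ζ, η) = tr (ζ (αᵀα)⁻¹ ηᵀ)` at `x` does not depend on the basis of `TₓM`; the coordinate
basis of the chart around `x` is used. -/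
def ebinMetric {n : ℕ} (α ζ η : OneForm I M n) : ℝ :=
  ∫ x, traceForm (frameMatrix (α x) (coordFrame I x x)) (frameMatrix (ζ x) (coordFrame I x x))
    (frameMatrix (η x) (coordFrame I x x)) ∂(oneFormVolume α)

/-- The geodesic distance of the generalized Ebin metric on `Ω¹₊(M, ℝⁿ)`. -/
def ebinDist {n : ℕ} (α β : OneForm I M n) : ℝ≥0∞ :=
  geodesicDist (fullRankOneForms I M n) ebinMetric α β

end Manifold

end GeneralizedEbin

end

/-!
A curve `γ` of full rank one-forms gives at every point `x` of `M` a curve `s ↦ γ(s)(x)` of full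
rank matrices, once a basis of the tangent space is chosen. The Ebin metric is the integral over
`M` of the pointwise metric: with `f(s, x)² = ⟨γ'(s)(x), γ'(s)(x)⟩ / |μ(e(x))|`, which does not
depend on the frame `e` (`metricDensity_eq_of_basis`), one has `G(γ', γ') = ∫_M f(s, x)² μ`
(`ofReal_ebinMetric`). For frames of unit volume, `∫₀¹ f(s, x) ds` is the length of the curve of
matrices at `x` and so bounds the distance of `α(x)` and `β(x)`. Minkowski's integral inequality
`‖∫₀¹ f(s, ·) ds‖ ≤ ∫₀¹ ‖f(s, ·)‖ ds` in `L²(M, μ)` (`sq_lintegral_le`), whose right hand side is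
the length of `γ`, gives the comparison (`lintegral_matrixDist_sq_le`). The joint measurability
which it needs holds since `f` is continuous in `x` and piecewise continuous in `s`
(`aemeasurable_uncurry_of_pieces`), evaluation at a point being continuous for the Fréchet topology
(`continuous_frameMatrixMap`).

The distance on matrices is non-degenerate because the metric locally dominates a multiple of
a norm. The lower bound is locally uniform in the first matrix (`exists_le_matrixDist`). So if
`α` and `β` differ at a point, then the integrand of the comparison is bounded below on a
neighbourhood of that point, and the measure of `μ` is positive on open sets
(`isOpenPosMeasure_densityMeasure`). Hence the distance of `α` and `β` is positive
(`eq_of_ebinDist_eq_zero`).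
-/

noncomputable section

namespace GeneralizedEbin

/-! ### The metric on full rank matrices -/

section Matrices

variable {n m : ℕ}

theorem posDef_gram_of_mulVec_injective {a : Matrix (Fin n) (Fin m) ℝ}
    (ha : Function.Injective a.mulVec) : (aᵀ * a).PosDef := by
  refine Matrix.PosDef.of_dotProduct_mulVec_pos ?_ fun x hx => ?_
  · simp [Matrix.IsHermitian, Matrix.conjTranspose_eq_transpose_of_trivial]
  · have h : a *ᵥ x ≠ 0 := fun h => hx (ha (by simpa using h))
    have : star x ⬝ᵥ ((aᵀ * a) *ᵥ x) = (a *ᵥ x) ⬝ᵥ (a *ᵥ x) := by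
      rw [← Matrix.mulVec_mulVec, Matrix.dotProduct_mulVec, Matrix.vecMul_transpose]
      rfl
    rw [this]
    exact lt_of_le_of_ne (Finset.sum_nonneg fun i _ => mul_self_nonneg _)
      (fun h0 => h (dotProduct_self_eq_zero.1 h0.symm))

theorem mem_fullRankMatrices_iff_det {a : Matrix (Fin n) (Fin m) ℝ} :
    a ∈ fullRankMatrices n m ↔ (aᵀ * a).det ≠ 0 := by
  change a.rank = m ↔ _
  rw [← Matrix.rank_transpose_mul_self]
  constructor
  · intro h
    rw [← isUnit_iff_ne_zero, ← Matrix.isUnit_iff_isUnit_det, ← Matrix.mulVec_injective_iff_isUnit]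
    change Function.Injective (aᵀ * a).mulVecLin
    refine LinearMap.injective_iff_surjective.2 (LinearMap.range_eq_top.1 ?_)
    apply Submodule.eq_top_of_finrank_eq
    rw [Matrix.rank] at h
    rw [h]
    simp
  · intro h
    rw [Matrix.rank_of_isUnit _ ((Matrix.isUnit_iff_isUnit_det _).2 (isUnit_iff_ne_zero.2 h))]
    simp

theorem mem_fullRankMatrices_of_mulVec_injective {a : Matrix (Fin n) (Fin m) ℝ}
    (ha : Function.Injective a.mulVec) : a ∈ fullRankMatrices n m :=
  mem_fullRankMatrices_iff_det.2 (posDef_gram_of_mulVec_injective ha).det_pos.ne'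

theorem posDef_gram {a : Matrix (Fin n) (Fin m) ℝ} (ha : a ∈ fullRankMatrices n m) :
    (aᵀ * a).PosDef := by
  refine posDef_gram_of_mulVec_injective fun x y hxy => ?_
  have hu : IsUnit (aᵀ * a) :=
    (Matrix.isUnit_iff_isUnit_det _).2 (isUnit_iff_ne_zero.2 (mem_fullRankMatrices_iff_det.1 ha))
  apply Matrix.mulVec_injective_iff_isUnit.2 hu
  simp only [← Matrix.mulVec_mulVec]
  exact congrArg _ hxy

theorem traceForm_self {a : Matrix (Fin n) (Fin m) ℝ} (u : Matrix (Fin n) (Fin m) ℝ) :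
    traceForm a u u = ∑ i, u i ⬝ᵥ ((aᵀ * a)⁻¹ *ᵥ u i) := by
  simp only [traceForm, Matrix.trace, Matrix.diag]
  refine Finset.sum_congr rfl fun i _ => ?_
  rw [Matrix.dotProduct_mulVec]
  rfl

theorem traceForm_self_nonneg {a : Matrix (Fin n) (Fin m) ℝ} (ha : a ∈ fullRankMatrices n m)
    (u : Matrix (Fin n) (Fin m) ℝ) : 0 ≤ traceForm a u u := by
  rw [traceForm_self]
  exact Finset.sum_nonneg fun i _ =>
    by simpa using (posDef_gram ha).inv.posSemidef.dotProduct_mulVec_nonneg (u i)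

theorem traceForm_self_pos {a : Matrix (Fin n) (Fin m) ℝ} (ha : a ∈ fullRankMatrices n m)
    {u : Matrix (Fin n) (Fin m) ℝ} (hu : u ≠ 0) : 0 < traceForm a u u := by
  rw [traceForm_self]
  obtain ⟨i, hi⟩ : ∃ i, u i ≠ 0 := by
    by_contra! h
    exact hu (funext h)
  refine Finset.sum_pos' (fun i _ => ?_) ⟨i, Finset.mem_univ i, ?_⟩
  · simpa using (posDef_gram ha).inv.posSemidef.dotProduct_mulVec_nonneg (u i)
  · simpa using (posDef_gram ha).inv.dotProduct_mulVec_pos hi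

theorem matrixMetric_self_pos {a : Matrix (Fin n) (Fin m) ℝ} (ha : a ∈ fullRankMatrices n m)
    {u : Matrix (Fin n) (Fin m) ℝ} (hu : u ≠ 0) : 0 < matrixMetric a u u :=
  mul_pos (traceForm_self_pos ha hu) (Real.sqrt_pos.2 (posDef_gram ha).det_pos)

theorem matrixMetric_smul (a u : Matrix (Fin n) (Fin m) ℝ) (r : ℝ) :
    matrixMetric a (r • u) (r • u) = r ^ 2 * matrixMetric a u u := by
  simp [matrixMetric, traceForm, Matrix.trace_smul]
  ring

theorem traceForm_mul_right (a u v : Matrix (Fin n) (Fin m) ℝ) {P : Matrix (Fin m) (Fin m) ℝ}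
    (hP : IsUnit P) : traceForm (a * P) (u * P) (v * P) = traceForm a u v := by
  have hd := (Matrix.isUnit_iff_isUnit_det _).1 hP
  have hdt : IsUnit (Pᵀ).det := by rwa [Matrix.det_transpose]
  have h : (a * P)ᵀ * (a * P) = Pᵀ * ((aᵀ * a) * P) := by
    simp only [Matrix.transpose_mul, Matrix.mul_assoc]
  simp only [traceForm]
  rw [h, Matrix.mul_inv_rev, Matrix.mul_inv_rev, Matrix.transpose_mul]
  congr 1
  simp only [Matrix.mul_assoc]
  rw [← Matrix.mul_assoc P P⁻¹, Matrix.mul_nonsing_inv P hd, Matrix.one_mul,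
    ← Matrix.mul_assoc (Pᵀ)⁻¹ Pᵀ, Matrix.nonsing_inv_mul _ hdt, Matrix.one_mul]

theorem sqrt_det_gram_mul_right (a : Matrix (Fin n) (Fin m) ℝ) (P : Matrix (Fin m) (Fin m) ℝ) :
    √(((a * P)ᵀ * (a * P)).det) = √((aᵀ * a).det) * |P.det| := by
  have h : (a * P)ᵀ * (a * P) = Pᵀ * ((aᵀ * a) * P) := by
    simp only [Matrix.transpose_mul, Matrix.mul_assoc]
  rw [h, Matrix.det_mul, Matrix.det_mul, Matrix.det_transpose,
    show P.det * ((aᵀ * a).det * P.det) = (aᵀ * a).det * P.det ^ 2 by ring,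
    Real.sqrt_mul' _ (sq_nonneg _), Real.sqrt_sq_eq_abs]

theorem matrixMetric_mul_right (a u v : Matrix (Fin n) (Fin m) ℝ)
    {P : Matrix (Fin m) (Fin m) ℝ} (hP : IsUnit P) :
    matrixMetric (a * P) (u * P) (v * P) = matrixMetric a u v * |P.det| := by
  rw [matrixMetric, traceForm_mul_right a u v hP, sqrt_det_gram_mul_right, matrixMetric, mul_assoc]

variable {X : Type*} [TopologicalSpace X] {s : Set X} {a u v : X → Matrix (Fin n) (Fin m) ℝ}

theorem continuousOn_sqrt_det_gram (ha : ContinuousOn a s) :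
    ContinuousOn (fun x => √(((a x)ᵀ * a x).det)) s := by
  rw [continuousOn_iff_continuous_domRestrict] at *
  exact (ha.matrix_transpose.matrix_mul ha).matrix_det.sqrt

theorem continuousOn_traceForm (ha : ContinuousOn a s) (hu : ContinuousOn u s)
    (hv : ContinuousOn v s) (h : ∀ x ∈ s, a x ∈ fullRankMatrices n m) :
    ContinuousOn (fun x => traceForm (a x) (u x) (v x)) s := by
  rw [continuousOn_iff_continuous_domRestrict] at *
  have hA : Continuous fun x : s => (a x)ᵀ * a x := ha.matrix_transpose.matrix_mul ha
  have hinv : Continuous fun x : s => ((a x)ᵀ * a x)⁻¹ := by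
    simp only [Matrix.inv_def, Ring.inverse_eq_inv']
    exact (hA.matrix_det.inv₀ fun x => mem_fullRankMatrices_iff_det.1 (h x x.2)).smul
      hA.matrix_adjugate
  exact ((hu.matrix_mul hinv).matrix_mul hv.matrix_transpose).matrix_trace

theorem continuousOn_matrixMetric (ha : ContinuousOn a s) (hu : ContinuousOn u s)
    (hv : ContinuousOn v s) (h : ∀ x ∈ s, a x ∈ fullRankMatrices n m) :
    ContinuousOn (fun x => matrixMetric (a x) (u x) (v x)) s :=
  (continuousOn_traceForm ha hu hv h).mul (continuousOn_sqrt_det_gram ha)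

theorem isOpen_fullRankMatrices : IsOpen (fullRankMatrices n m) := by
  have : fullRankMatrices n m = {a | (aᵀ * a).det ≠ 0} :=
    Set.ext fun a => mem_fullRankMatrices_iff_det
  rw [this]
  exact isOpen_ne_fun ((continuous_id.matrix_transpose.matrix_mul continuous_id).matrix_det)
    continuous_const

/-- Near a full rank matrix the metric dominates a multiple of the sup norm, by compactness of
`closed ball × unit sphere`. -/
theorem exists_le_sqrt_matrixMetric {a : Matrix (Fin n) (Fin m) ℝ}
    (ha : a ∈ fullRankMatrices n m) :
    ∃ r > 0, ∃ c > 0, ∀ p : Matrix (Fin n) (Fin m) ℝ, (∀ i j, |p i j - a i j| ≤ r) →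
      ∀ (u : Matrix (Fin n) (Fin m) ℝ) (i : Fin n) (j : Fin m),
        c * |u i j| ≤ √(matrixMetric p u u) := by
  -- The function space `E` carries the sup norm, while matrices have no global norm instance.
  let E := Fin n → Fin m → ℝ
  let a' : E := a
  have hopen : IsOpen {p : E | Matrix.of p ∈ fullRankMatrices n m} := isOpen_fullRankMatrices
  obtain ⟨r, hr, hball⟩ := Metric.nhds_basis_closedBall.mem_iff.1
    (hopen.mem_nhds (show a' ∈ {p : E | Matrix.of p ∈ fullRankMatrices n m} from ha))
  have hcomp : IsCompact (Metric.closedBall a' r ×ˢ Metric.sphere (0 : E) 1) :=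
    (isCompact_closedBall _ _).prod (isCompact_sphere _ _)
  have hcont : ContinuousOn (fun q : E × E => matrixMetric (Matrix.of q.1) (Matrix.of q.2)
      (Matrix.of q.2)) (Metric.closedBall a' r ×ˢ Metric.sphere (0 : E) 1) :=
    continuousOn_matrixMetric (a := fun q : E × E => Matrix.of q.1) continuous_fst.continuousOn
      (u := fun q : E × E => Matrix.of q.2) continuous_snd.continuousOn
      (v := fun q : E × E => Matrix.of q.2) continuous_snd.continuousOn fun q hq => hball hq.1
  obtain ⟨c, hc, hcle⟩ := hcomp.exists_forall_le' hcont (a := 0) fun q hq =>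
    matrixMetric_self_pos (hball hq.1) fun h0 => by
      have h1 : ‖q.2‖ = 1 := by simpa using hq.2
      rw [show q.2 = 0 from h0, norm_zero] at h1
      exact zero_ne_one h1
  refine ⟨r, hr, √c, Real.sqrt_pos.2 hc, fun p hp u i j => ?_⟩
  have hpE : (show E from p) ∈ Metric.closedBall a' r := by
    rw [Metric.mem_closedBall, dist_pi_le_iff hr.le]
    intro i
    rw [dist_pi_le_iff hr.le]
    exact fun j => hp i j
  let u' : E := u
  by_cases hu : u' = 0
  · rw [show u i j = 0 from congrFun (congrFun hu i) j]
    simp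
  · have hpos : 0 < ‖u'‖ := norm_pos_iff.2 hu
    have h1 := hcle ((show E from p), ‖u'‖⁻¹ • u') ⟨hpE, by
      simp [norm_smul, hpos.ne']⟩
    have h2 : c * ‖u'‖ ^ 2 ≤ matrixMetric p u u := by
      have h3 : matrixMetric p (‖u'‖⁻¹ • u) (‖u'‖⁻¹ • u) =
        (‖u'‖⁻¹) ^ 2 * matrixMetric p u u := matrixMetric_smul p u _
      have h4 : c ≤ (‖u'‖⁻¹) ^ 2 * matrixMetric p u u := h3 ▸ h1
      rw [inv_pow, inv_mul_eq_div, le_div_iff₀ (by positivity)] at h4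
      exact h4
    have h5 : |u i j| ≤ ‖u'‖ := (norm_le_pi_norm (u' i) j).trans (norm_le_pi_norm u' i)
    calc √c * |u i j| ≤ √c * ‖u'‖ := by gcongr
      _ = √(c * ‖u'‖ ^ 2) := by rw [Real.sqrt_mul hc.le, Real.sqrt_sq hpos.le]
      _ ≤ _ := Real.sqrt_le_sqrt h2

end Matrices

/-! ### Piecewise differentiable curves -/

section Curves

theorem exists_mem_Icc_succ {t : ℕ → ℝ} {s : ℝ} :
    ∀ {k : ℕ}, t 0 ≤ s → s ≤ t k → 0 < k → ∃ i < k, s ∈ Icc (t i) (t (i + 1))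
  | 0, _, _, h => absurd h (lt_irrefl 0)
  | k + 1, h0, hk, _ => by
    rcases Nat.eq_zero_or_pos k with rfl | hpos
    · exact ⟨0, zero_lt_one, h0, hk⟩
    rcases le_total (t k) s with h | h
    · exact ⟨k, k.lt_succ_self, h, hk⟩
    · obtain ⟨i, hi, his⟩ := exists_mem_Icc_succ h0 h hpos
      exact ⟨i, hi.trans k.lt_succ_self, his⟩

/-- A partition of `[0,1]` into closed pieces covers `[0,1]`. -/
theorem Icc_zero_one_subset_iUnion {t : ℕ → ℝ} {k : ℕ} (h0 : t 0 = 0) (hk : t k = 1) :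
    Icc (0 : ℝ) 1 ⊆ ⋃ i : Fin k, Icc (t i) (t (i + 1)) := fun s hs => by
  have hpos : 0 < k := by
    rcases Nat.eq_zero_or_pos k with rfl | h
    · linarith
    · exact h
  obtain ⟨i, hi, his⟩ := exists_mem_Icc_succ (h0 ▸ hs.1) (hk ▸ hs.2) hpos
  exact mem_iUnion.2 ⟨⟨i, hi⟩, his⟩

/-- Outside of the break points, the open pieces of a partition cover `[0,1]`. -/
theorem Icc_zero_one_diff_subset_iUnion {t : ℕ → ℝ} {k : ℕ} (h0 : t 0 = 0) (hk : t k = 1) :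
    Icc (0 : ℝ) 1 \ range t ⊆ ⋃ i : Fin k, Ioo (t i) (t (i + 1)) := fun s hs => by
  obtain ⟨i, hi⟩ := mem_iUnion.1 (Icc_zero_one_subset_iUnion h0 hk hs.1)
  exact mem_iUnion.2 ⟨i, lt_of_le_of_ne hi.1 fun h => hs.2 ⟨_, h⟩,
    lt_of_le_of_ne hi.2 fun h => hs.2 ⟨_, h.symm⟩⟩

section Vector

variable {V W : Type*} [AddCommGroup V] [Module ℝ V] [TopologicalSpace V]
  [AddCommGroup W] [Module ℝ W] [TopologicalSpace W] {γ γ' : ℝ → V}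

theorem IsPiecewiseC1.map (h : IsPiecewiseC1 γ γ') (L : V →ₗ[ℝ] W) (hL : Continuous L) :
    IsPiecewiseC1 (fun s => L (γ s)) (fun s => L (γ' s)) := by
  obtain ⟨k, t, ht, h0, hk, hpiece⟩ := h
  refine ⟨k, t, ht, h0, hk, fun i hi => ?_⟩
  obtain ⟨g, hg, hslope, heq⟩ := hpiece i hi
  refine ⟨fun s => L (g s), hL.comp_continuousOn hg, fun s hs => ?_,
    fun s hs => congrArg L (heq hs)⟩
  have : slope (fun s => L (γ s)) s = fun r => L (slope γ s r) := by
    funext r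
    simp [slope]
  rw [this]
  exact (hL.tendsto _).comp (hslope s hs)

theorem isPiecewiseC1_const (p : V) : IsPiecewiseC1 (fun _ => p) (fun _ => (0 : V)) := by
  refine ⟨1, fun i => i, fun i j h => by simpa using h, by simp, by simp, fun i _ =>
    ⟨fun _ => 0, continuousOn_const, fun s _ => ?_, fun _ _ => rfl⟩⟩
  have : slope (fun _ : ℝ => p) s = fun _ => 0 := by
    funext r
    simp [slope]
  rw [this]
  exact tendsto_const_nhds

theorem geodesicDist_le {U : Set V} {g : V → V → V → ℝ} {p q : V} (hγ : IsPiecewiseC1 γ γ')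
    (hU : ∀ s ∈ Icc (0 : ℝ) 1, γ s ∈ U) (h0 : γ 0 = p) (h1 : γ 1 = q) :
    geodesicDist U g p q ≤
      ∫⁻ s in Icc (0 : ℝ) 1, ENNReal.ofReal (√(g (γ s) (γ' s) (γ' s))) :=
  iInf_le_of_le γ <| iInf_le_of_le γ' <| iInf_le_of_le hγ <| iInf_le_of_le hU <|
    iInf_le_of_le h0 <| iInf_le_of_le h1 le_rfl

theorem geodesicDist_self {U : Set V} {g : V → V → V → ℝ} {p : V} (hp : p ∈ U)
    (hg : g p 0 0 = 0) : geodesicDist U g p p = 0 :=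
  le_antisymm ((geodesicDist_le (isPiecewiseC1_const p) (fun _ _ => hp) rfl rfl).trans
    (by simp [hg])) zero_le

end Vector

variable {γ γ' : ℝ → ℝ}

theorem IsPiecewiseC1.continuousOn (h : IsPiecewiseC1 γ γ') : ContinuousOn γ (Icc 0 1) := by
  obtain ⟨k, t, -, h0, hk, hpiece⟩ := h
  refine ContinuousOn.mono ?_ (Icc_zero_one_subset_iUnion h0 hk)
  refine (locallyFinite_of_finite _).continuousOn_iUnion (fun i => isClosed_Icc) fun i s hs => ?_
  obtain ⟨g, -, hslope, -⟩ := hpiece i i.2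
  exact (hasDerivWithinAt_iff_tendsto_slope.2 (hslope s hs)).continuousWithinAt

theorem IsPiecewiseC1.intervalIntegrable (h : IsPiecewiseC1 γ γ') :
    IntervalIntegrable γ' volume 0 1 := by
  obtain ⟨k, t, ht, h0, hk, hpiece⟩ := h
  rw [← h0, ← hk]
  refine IntervalIntegrable.trans_iterate fun i hi => ?_
  obtain ⟨g, hg, -, heq⟩ := hpiece i hi
  have hle : t i ≤ t (i + 1) := ht i.le_succ
  rw [intervalIntegrable_iff_integrableOn_Ioo_of_le hle]
  refine IntegrableOn.congr_fun ?_ heq.symm measurableSet_Ioo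
  exact (hg.integrableOn_Icc).mono_set Ioo_subset_Icc_self

theorem IsPiecewiseC1.hasDerivAt (h : IsPiecewiseC1 γ γ') :
    ∃ S : Set ℝ, S.Countable ∧ ∀ s ∈ Icc (0 : ℝ) 1 \ S, HasDerivAt γ (γ' s) s := by
  obtain ⟨k, t, -, h0, hk, hpiece⟩ := h
  refine ⟨range t, countable_range t, fun s hs => ?_⟩
  obtain ⟨i, hi⟩ := mem_iUnion.1 (Icc_zero_one_diff_subset_iUnion h0 hk hs)
  obtain ⟨g, -, hslope, heq⟩ := hpiece i i.2
  rw [heq hi]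
  exact (hasDerivWithinAt_iff_tendsto_slope.2 (hslope s (Ioo_subset_Icc_self hi))).hasDerivAt
    (Icc_mem_nhds hi.1 hi.2)

theorem IsPiecewiseC1.enorm_sub_le (h : IsPiecewiseC1 γ γ') {τ : ℝ} (hτ : τ ∈ Icc (0 : ℝ) 1) :
    ‖γ τ - γ 0‖ₑ ≤ ∫⁻ s in Ioo 0 τ, ‖γ' s‖ₑ := by
  obtain ⟨S, hS, hd⟩ := h.hasDerivAt
  have hint := integral_eq_of_hasDerivAt_off_countable_of_le γ γ' hτ.1 hS
    (h.continuousOn.mono (Icc_subset_Icc_right hτ.2))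
    (fun s hs => hd s ⟨⟨hs.1.1.le, hs.1.2.le.trans hτ.2⟩, hs.2⟩)
    (h.intervalIntegrable.mono_set (by
      rw [uIcc_of_le hτ.1, uIcc_of_le zero_le_one]
      exact Icc_subset_Icc_right hτ.2))
  rw [← hint, intervalIntegral.integral_of_le hτ.1, integral_Ioc_eq_integral_Ioo]
  exact enorm_integral_le_lintegral_enorm _

end Curves

/-! ### A local lower bound for the distance on full rank matrices -/

/-- The linear functional reading off one entry of a matrix. -/
def matrixEntry {n m : ℕ} (i : Fin n) (j : Fin m) : Matrix (Fin n) (Fin m) ℝ →ₗ[ℝ] ℝ where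
  toFun a := a i j
  map_add' _ _ := rfl
  map_smul' _ _ := rfl

/-- Up to the first time at which an entry of a curve from `a` to `b` has moved by a fixed small
amount, the curve stays where the metric dominates `c` times the sup norm. This bounds its length
from below. The constants are uniform in `a` near `a₀`. -/
theorem exists_le_matrixDist {n m : ℕ} {a₀ : Matrix (Fin n) (Fin m) ℝ}
    (ha₀ : a₀ ∈ fullRankMatrices n m) :
    ∃ r > 0, ∃ c > 0, ∀ a b : Matrix (Fin n) (Fin m) ℝ, (∀ i j, |a i j - a₀ i j| ≤ r) →
      ∀ i j, ENNReal.ofReal (c * min r |b i j - a i j|) ≤ matrixDist a b := by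
  obtain ⟨r, hr, c, hc, hle⟩ := exists_le_sqrt_matrixMetric ha₀
  refine ⟨r / 2, half_pos hr, c, hc, fun a b ha i₀ j₀ => ?_⟩
  set ρ := min (r / 2) |b i₀ j₀ - a i₀ j₀|
  refine le_iInf₂ fun γ γ' => le_iInf₂ fun hγ _ => le_iInf₂ fun h0 h1 => ?_
  have hentry : ∀ i j, IsPiecewiseC1 (fun s => γ s i j) (fun s => γ' s i j) := fun i j =>
    hγ.map (matrixEntry i j) (continuous_id.matrix_elem i j)
  let S : Set ℝ := ⋃ i, ⋃ j, Icc (0 : ℝ) 1 ∩ {s | ρ ≤ |γ s i j - a i j|}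
  have hS : IsClosed S := by
    refine isClosed_iUnion_of_finite fun i => isClosed_iUnion_of_finite fun j => ?_
    exact (((hentry i j).continuousOn.sub continuousOn_const).abs).preimage_isClosed_of_isClosed
      isClosed_Icc isClosed_Ici
  have hsub : S ⊆ Icc 0 1 := iUnion_subset fun i => iUnion_subset fun j => inter_subset_left
  have hne : S.Nonempty := ⟨1, mem_iUnion.2 ⟨i₀, mem_iUnion.2 ⟨j₀, by simp, by
    simp only [mem_ofPred_eq, h1]
    exact min_le_right _ _⟩⟩⟩
  obtain ⟨τ, hτ, hmin⟩ := (isCompact_Icc.of_isClosed_subset hS hsub).exists_isLeast hne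
  obtain ⟨i, hi⟩ := mem_iUnion.1 hτ
  obtain ⟨j, hτ01, hij⟩ := mem_iUnion.1 hi
  have hbefore : ∀ s ∈ Ioo 0 τ, ∀ i j, |γ s i j - a₀ i j| ≤ r := fun s hs i j => by
    have hlt : |γ s i j - a i j| < r / 2 := by
      by_contra! hlt
      exact (hmin (mem_iUnion.2 ⟨i, mem_iUnion.2 ⟨j, ⟨hs.1.le, hs.2.le.trans hτ01.2⟩,
        (min_le_left _ _).trans hlt⟩⟩)).not_gt hs.2
    calc |γ s i j - a₀ i j| ≤ |γ s i j - a i j| + |a i j - a₀ i j| := abs_sub_le _ _ _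
      _ ≤ r / 2 + r / 2 := add_le_add hlt.le (ha i j)
      _ = r := add_halves r
  calc ENNReal.ofReal (c * ρ) ≤ ENNReal.ofReal c * ‖γ τ i j - γ 0 i j‖ₑ := by
        rw [ENNReal.ofReal_mul hc.le, Real.enorm_eq_ofReal_abs, h0]
        gcongr
        exact hij
    _ ≤ ENNReal.ofReal c * ∫⁻ s in Ioo 0 τ, ‖γ' s i j‖ₑ := by
        gcongr
        exact (hentry i j).enorm_sub_le hτ01
    _ = ∫⁻ s in Ioo 0 τ, ENNReal.ofReal c * ‖γ' s i j‖ₑ :=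
        (lintegral_const_mul' _ _ ENNReal.ofReal_ne_top).symm
    _ ≤ ∫⁻ s in Ioo 0 τ, ENNReal.ofReal (√(matrixMetric (γ s) (γ' s) (γ' s))) := by
        refine setLIntegral_mono' measurableSet_Ioo fun s hs => ?_
        rw [Real.enorm_eq_ofReal_abs, ← ENNReal.ofReal_mul hc.le]
        exact ENNReal.ofReal_le_ofReal (hle _ (hbefore s hs) _ i j)
    _ ≤ _ := lintegral_mono_set (Ioo_subset_Icc_self.trans (Icc_subset_Icc_right hτ01.2))

/-! ### Minkowski's integral inequality and joint measurability -/

section Minkowski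

variable {S X : Type*} [MeasurableSpace S] [MeasurableSpace X]

theorem lintegral_mul_le_sqrt_mul_sqrt (ν : Measure X) {g h : X → ℝ≥0∞} (hg : AEMeasurable g ν)
    (hh : AEMeasurable h ν) :
    ∫⁻ x, g x * h x ∂ν ≤
      (∫⁻ x, g x ^ 2 ∂ν) ^ (1 / 2 : ℝ) * (∫⁻ x, h x ^ 2 ∂ν) ^ (1 / 2 : ℝ) := by
  have := ENNReal.lintegral_mul_le_Lp_mul_Lq ν Real.HolderConjugate.two_two hg hh
  simpa using this

theorem sq_lintegral_le_of_measurable (κ : Measure S) (ν : Measure X) [SFinite κ] [SFinite ν]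
    {f : S → X → ℝ≥0∞} (hf : Measurable (Function.uncurry f)) :
    ∫⁻ x, (∫⁻ s, f s x ∂κ) ^ 2 ∂ν ≤
      (∫⁻ s, (∫⁻ x, f s x ^ 2 ∂ν) ^ (1 / 2 : ℝ) ∂κ) ^ 2 := by
  have hfs : ∀ s, Measurable (f s) := fun s => hf.comp measurable_prodMk_left
  have hfx : ∀ x, Measurable fun s => f s x := fun x => hf.comp measurable_prodMk_right
  have hF : Measurable fun x => ∫⁻ t, f t x ∂κ := hf.lintegral_prod_left'
  have hN : Measurable fun s => (∫⁻ x, f s x ^ 2 ∂ν) ^ (1 / 2 : ℝ) :=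
    ((hf.pow_const 2).lintegral_prod_right').pow_const _
  set N : S → ℝ≥0∞ := fun s => (∫⁻ x, f s x ^ 2 ∂ν) ^ (1 / 2 : ℝ) with hNdef
  calc ∫⁻ x, (∫⁻ s, f s x ∂κ) ^ 2 ∂ν
      = ∫⁻ x, ∫⁻ s, f s x * ∫⁻ t, f t x ∂κ ∂κ ∂ν := by
        refine lintegral_congr fun x => ?_
        rw [lintegral_mul_const _ (hfx x), sq]
    _ = ∫⁻ s, ∫⁻ x, f s x * ∫⁻ t, f t x ∂κ ∂ν ∂κ := by
        refine lintegral_lintegral_swap (Measurable.aemeasurable ?_)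
        exact (hf.comp measurable_swap).mul (hF.comp measurable_fst)
    _ = ∫⁻ s, ∫⁻ x, ∫⁻ t, f s x * f t x ∂κ ∂ν ∂κ := by
        refine lintegral_congr fun s => lintegral_congr fun x => ?_
        rw [lintegral_const_mul _ (hfx x)]
    _ = ∫⁻ s, ∫⁻ t, ∫⁻ x, f s x * f t x ∂ν ∂κ ∂κ := by
        refine lintegral_congr fun s => lintegral_lintegral_swap (Measurable.aemeasurable ?_)
        exact ((hfs s).comp measurable_fst).mul (hf.comp measurable_swap)
    _ ≤ ∫⁻ s, ∫⁻ t, N s * N t ∂κ ∂κ :=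
        lintegral_mono fun s => lintegral_mono fun t =>
          lintegral_mul_le_sqrt_mul_sqrt ν (hfs s).aemeasurable (hfs t).aemeasurable
    _ = (∫⁻ s, N s ∂κ) ^ 2 := by
        simp_rw [lintegral_const_mul _ hN]
        rw [lintegral_mul_const _ hN, sq]

/-- Minkowski's integral inequality for the exponent two. Both sides are squared, so that by
Tonelli's theorem it reduces to the Cauchy–Schwarz inequality and no finiteness is needed. -/
theorem sq_lintegral_le (κ : Measure S) (ν : Measure X) [SFinite κ] [SFinite ν]
    {f : S → X → ℝ≥0∞} (hf : AEMeasurable (Function.uncurry f) (κ.prod ν)) :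
    ∫⁻ x, (∫⁻ s, f s x ∂κ) ^ 2 ∂ν ≤
      (∫⁻ s, (∫⁻ x, f s x ^ 2 ∂ν) ^ (1 / 2 : ℝ) ∂κ) ^ 2 := by
  let g : S → X → ℝ≥0∞ := fun s x => hf.mk _ (s, x)
  have hg : Measurable (Function.uncurry g) := hf.measurable_mk
  have h1 : ∀ᵐ s ∂κ, ∀ᵐ x ∂ν, f s x = g s x := Measure.ae_ae_of_ae_prod hf.ae_eq_mk
  have h2 : ∀ᵐ x ∂ν, ∀ᵐ s ∂κ, f s x = g s x :=
    Measure.ae_ae_of_ae_prod (Measure.measurePreserving_swap.quasiMeasurePreserving.ae hf.ae_eq_mk)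
  calc ∫⁻ x, (∫⁻ s, f s x ∂κ) ^ 2 ∂ν = ∫⁻ x, (∫⁻ s, g s x ∂κ) ^ 2 ∂ν := by
        refine lintegral_congr_ae ?_
        filter_upwards [h2] with x hx
        rw [lintegral_congr_ae hx]
    _ ≤ (∫⁻ s, (∫⁻ x, g s x ^ 2 ∂ν) ^ (1 / 2 : ℝ) ∂κ) ^ 2 := sq_lintegral_le_of_measurable κ ν hg
    _ = _ := by
        congr 1
        refine lintegral_congr_ae ?_
        filter_upwards [h1] with s hs
        congr 1
        refine lintegral_congr_ae ?_
        filter_upwards [hs] with x hx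
        rw [hx]

/-- A function of time and space which on the pieces of a partition of `[0,1]` is continuous in
time and measurable in space is jointly measurable up to a null set. -/
theorem aemeasurable_uncurry_of_pieces (ν : Measure X) [SFinite ν] {f : ℝ → X → ℝ} {k : ℕ}
    {t : ℕ → ℝ} (ht : Monotone t) (h0 : t 0 = 0) (hk : t k = 1)
    (h : ∀ i < k, ∃ u : ℝ → X → ℝ,
      (∀ x, ContinuousOn (fun s => u s x) (Icc (t i) (t (i + 1)))) ∧
      (∀ s ∈ Icc (t i) (t (i + 1)), Measurable (u s)) ∧
      ∀ s ∈ Ioo (t i) (t (i + 1)), f s = u s) :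
    AEMeasurable (Function.uncurry f) ((volume.restrict (Icc (0 : ℝ) 1)).prod ν) := by
  have hae : (Icc (0 : ℝ) 1 : Set ℝ) ≤ᵐ[volume] ⋃ i : Fin k, Ioo (t i) (t (i + 1)) := by
    have hcount : ∀ᵐ s ∂(volume : Measure ℝ), s ∉ range t :=
      (countable_range t).ae_notMem volume
    filter_upwards [hcount] with s hs hs01
    exact Icc_zero_one_diff_subset_iUnion h0 hk ⟨hs01, hs⟩
  have hac : (volume.restrict (Icc (0 : ℝ) 1)).prod ν ≪
      (volume.restrict (⋃ i : Fin k, Ioo (t i) (t (i + 1)))).prod ν :=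
    Measure.AbsolutelyContinuous.prod (Measure.restrict_mono_ae hae).absolutelyContinuous
      Measure.AbsolutelyContinuous.rfl
  refine AEMeasurable.mono_ac ?_ hac
  rw [Measure.restrict_prod_eq_prod_univ, iUnion_prod_const, aemeasurable_iUnion_iff]
  intro i
  obtain ⟨u, hcont, hmeas, heq⟩ := h i i.2
  have hle : t i ≤ t (i + 1) := ht (Nat.le_succ _)
  have hu : Measurable (Function.uncurry fun (s : ℝ) x => u (projIcc _ _ hle s) x) :=
    measurable_uncurry_of_continuous_of_measurable
      (fun x => (hcont x).comp_continuous (continuous_subtype_val.comp continuous_projIcc)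
        fun s => (projIcc _ _ hle s).2)
      fun s => hmeas _ (projIcc _ _ hle s).2
  refine hu.aemeasurable.congr ?_
  refine (ae_restrict_iff' (measurableSet_Ioo.prod MeasurableSet.univ)).2 (ae_of_all _ ?_)
  rintro ⟨s, x⟩ ⟨hs, -⟩
  simp only [Function.uncurry_apply_pair]
  rw [projIcc_of_mem hle (Ioo_subset_Icc_self hs), heq s hs]

end Minkowski

/-! ### Frames and coefficients of one-forms -/

section Frames

variable {m n : ℕ} {H : Type*} [TopologicalSpace H]
  {I : ModelWithCorners ℝ (EuclideanSpace ℝ (Fin m)) H}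
  {M : Type*} [TopologicalSpace M] [ChartedSpace H M]

/-- The `i`-th component of an `ℝⁿ`-valued linear map. -/
def componentMap {x : M}
    (a : TangentSpace I x →L[ℝ] Bundle.Trivial M (EuclideanSpace ℝ (Fin n)) x) (i : Fin n) :
    TangentSpace I x →ₗ[ℝ] ℝ :=
  (EuclideanSpace.proj i : EuclideanSpace ℝ (Fin n) →L[ℝ] ℝ).toLinearMap ∘ₗ
    (show TangentSpace I x →ₗ[ℝ] EuclideanSpace ℝ (Fin n) from a.toLinearMap)

theorem frameMatrix_apply {x : M}
    (a : TangentSpace I x →L[ℝ] Bundle.Trivial M (EuclideanSpace ℝ (Fin n)) x)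
    (e : Fin m → TangentSpace I x) (i : Fin n) (j : Fin m) :
    frameMatrix a e i j = componentMap a i (e j) :=
  rfl

theorem eq_of_componentMap_eq {x : M}
    {a : TangentSpace I x →L[ℝ] Bundle.Trivial M (EuclideanSpace ℝ (Fin n)) x}
    {v w : TangentSpace I x} (h : ∀ i, componentMap a i v = componentMap a i w) : a v = a w :=
  show (show EuclideanSpace ℝ (Fin n) from a v) = (show EuclideanSpace ℝ (Fin n) from a w) from
    PiLp.ext h

theorem frameMatrix_change {x : M}
    (a : TangentSpace I x →L[ℝ] Bundle.Trivial M (EuclideanSpace ℝ (Fin n)) x)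
    (e e' : Module.Basis (Fin m) ℝ (TangentSpace I x)) :
    frameMatrix a e' = frameMatrix a e * e.toMatrix e' := by
  ext i j
  rw [frameMatrix_apply, Matrix.mul_apply]
  conv_lhs => rw [← e.sum_toMatrix_smul_self e' j]
  rw [map_sum]
  simp only [map_smul, smul_eq_mul, frameMatrix_apply, mul_comm]

theorem isUnit_toMatrix {x : M} (e e' : Module.Basis (Fin m) ℝ (TangentSpace I x)) :
    IsUnit (e.toMatrix e') := by
  rw [Matrix.isUnit_iff_isUnit_det]
  exact e.isUnit_det e'

theorem alternating_change {x : M} (η : TangentSpace I x [⋀^Fin m]→L[ℝ] ℝ)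
    (e e' : Module.Basis (Fin m) ℝ (TangentSpace I x)) :
    η e' = (e.toMatrix e').det * η e := by
  have := congrArg (fun f => f e') (AlternatingMap.eq_smul_basis_det e η.toAlternatingMap)
  simpa [Module.Basis.det_apply, mul_comm] using this

theorem frameMatrix_mulVec {x : M}
    (a : TangentSpace I x →L[ℝ] Bundle.Trivial M (EuclideanSpace ℝ (Fin n)) x)
    (e : Fin m → TangentSpace I x) (v : Fin m → ℝ) (i : Fin n) :
    (frameMatrix a e).mulVec v i = componentMap a i (∑ j, v j • e j) := by
  simp [Matrix.mulVec, dotProduct, frameMatrix_apply, mul_comm]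

theorem injective_mulVec_frameMatrix {x : M}
    {a : TangentSpace I x →L[ℝ] Bundle.Trivial M (EuclideanSpace ℝ (Fin n)) x}
    (ha : Function.Injective a) (e : Module.Basis (Fin m) ℝ (TangentSpace I x)) :
    Function.Injective (frameMatrix a e).mulVec := by
  intro v w h
  have h' : ∑ j, v j • e j = ∑ j, w j • e j :=
    ha (eq_of_componentMap_eq fun i => by simpa only [frameMatrix_mulVec] using congrFun h i)
  simpa only [← Module.Basis.equivFun_symm_apply, EmbeddingLike.apply_eq_iff_eq] using h'

theorem eq_of_frameMatrix_eq {x : M}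
    {a b : TangentSpace I x →L[ℝ] Bundle.Trivial M (EuclideanSpace ℝ (Fin n)) x}
    {e : Module.Basis (Fin m) ℝ (TangentSpace I x)} (h : frameMatrix a e = frameMatrix b e) :
    a = b := by
  have hlin : ∀ i, componentMap a i = componentMap b i := fun i =>
    e.ext fun j => congrFun (congrFun h i) j
  ext v i
  exact LinearMap.congr_fun (hlin i) v

variable [IsManifold I ∞ M]

theorem frameMatrix_mem_fullRankMatrices {α : OneForm I M n} (hα : α ∈ fullRankOneForms I M n)
    {x : M} (e : Module.Basis (Fin m) ℝ (TangentSpace I x)) :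
    frameMatrix (α x) e ∈ fullRankMatrices n m :=
  mem_fullRankMatrices_of_mulVec_injective (injective_mulVec_frameMatrix (hα x) e)

/-- The coordinate vectors of the chart around `c`, as a basis of the tangent space at a point of
the domain of that chart. -/
def coordBasis {c x : M} (hx : x ∈ (chartAt H c).source) :
    Module.Basis (Fin m) ℝ (TangentSpace I x) :=
  (EuclideanSpace.basisFun (Fin m) ℝ).toBasis.map
    ((trivializationAt (EuclideanSpace ℝ (Fin m)) (TangentSpace I) c).continuousLinearEquivAt ℝ x
      (by simpa using hx)).symm.toLinearEquiv

theorem coe_coordBasis {c x : M} (hx : x ∈ (chartAt H c).source) :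
    ⇑(coordBasis (I := I) hx) = coordFrame I c x := by
  funext j
  simp only [coordBasis, coordFrame, Module.Basis.map_apply, OrthonormalBasis.coe_toBasis,
    EuclideanSpace.basisFun_apply]
  exact congrFun (Trivialization.symm_continuousLinearEquivAt_eq _ _) _

theorem continuousOn_apply_coordFrame (α : OneForm I M n) (c : M) (j : Fin m) :
    ContinuousOn (fun x => show EuclideanSpace ℝ (Fin n) from α x (coordFrame I c x j))
      (chartAt H c).source := by
  have h := (trivializationAt (EuclideanSpace ℝ (Fin m) →L[ℝ] EuclideanSpace ℝ (Fin n))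
    (fun x : M => TangentSpace I x →L[ℝ] Bundle.Trivial M (EuclideanSpace ℝ (Fin n)) x)
    c).continuousOn
  have h2 := (h.comp α.contMDiff.continuous.continuousOn
    (s := (chartAt H c).source) (fun x hx => by simpa using hx)).snd
  refine (h2.clm_apply (continuousOn_const (c := EuclideanSpace.single j (1 : ℝ)))).congr
    fun x _ => ?_
  simp only [Function.comp_apply, hom_trivializationAt_apply]
  simp [ContinuousLinearMap.inCoordinates, coordFrame]

theorem continuousOn_frameMatrix (α : OneForm I M n) (c : M) :
    ContinuousOn (fun x => frameMatrix (α x) (coordFrame I c x)) (chartAt H c).source := by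
  refine continuousOn_pi.2 fun i => continuousOn_pi.2 fun j => ?_
  exact (EuclideanSpace.proj (𝕜 := ℝ) i).continuous.comp_continuousOn
    (continuousOn_apply_coordFrame α c j)

/-- Evaluation of one-forms on a frame at a point. -/
def frameMatrixMap (n : ℕ) {x : M} (e : Fin m → TangentSpace I x) :
    OneForm I M n →ₗ[ℝ] Matrix (Fin n) (Fin m) ℝ where
  toFun α := frameMatrix (α x) e
  map_add' _ _ := rfl
  map_smul' _ _ := rfl

/-- Evaluation is continuous for the Fréchet topology: convergence of order zero on the compact
set consisting of one point. -/
theorem continuous_frameMatrix_coordFrame (n : ℕ) (x : M) :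
    Continuous fun α : OneForm I M n => frameMatrix (α x) (coordFrame I x x) := by
  let y := extChartAt I x x
  let 𝔖 : Set (Set (EuclideanSpace ℝ (Fin m))) :=
    {K | IsCompact K ∧ K ⊆ (extChartAt I x).target}
  have h1 : Continuous fun α : OneForm I M n =>
      UniformOnFun.ofFun 𝔖
        (iteratedFDerivWithin ℝ 0 (coordRep x α) (extChartAt I x).target) :=
    continuous_iff_le_induced.2 (iInf₂_le x 0)
  have h2 : Continuous fun α : OneForm I M n => coordRep x α y := by
    have hy : {y} ∈ 𝔖 := ⟨isCompact_singleton,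
      singleton_subset_iff.2 (mem_extChartAt_target (I := I) x)⟩
    have h3 := (UniformOnFun.uniformContinuous_eval_of_mem _ 𝔖 (mem_singleton y) hy).continuous.comp
      h1
    exact (continuous_eval_const (0 : Fin 0 → EuclideanSpace ℝ (Fin m))).comp h3
  have hy : (extChartAt I x).symm y = x := extChartAt_to_inv x
  have h3 : ∀ α : OneForm I M n, coordRep x α y =
      fun j => show EuclideanSpace ℝ (Fin n) from α x (coordFrame I x x j) := fun α => by
    funext j
    exact congrArg
      (fun z => (show EuclideanSpace ℝ (Fin n) from α z (coordFrame I x z j))) hy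
  simp only [h3] at h2
  refine continuous_pi fun i => continuous_pi fun j => ?_
  exact (EuclideanSpace.proj (𝕜 := ℝ) i).continuous.comp ((continuous_apply j).comp h2)

theorem continuous_frameMatrixMap (n : ℕ) {x : M}
    (e : Module.Basis (Fin m) ℝ (TangentSpace I x)) :
    Continuous (frameMatrixMap (I := I) (M := M) n e) := by
  have h : ⇑(frameMatrixMap (I := I) (M := M) n e) = fun α : OneForm I M n =>
      frameMatrix (α x) (coordFrame I x x) *
        (coordBasis (I := I) (mem_chart_source H x)).toMatrix e := by
    funext α
    rw [← coe_coordBasis (mem_chart_source H x)]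
    exact frameMatrix_change _ _ _
  rw [h]
  exact (continuous_frameMatrix_coordFrame n x).matrix_mul continuous_const

end Frames

/-! ### Integration against densities -/

section Densities

variable {m : ℕ} {H : Type*} [TopologicalSpace H]
  {I : ModelWithCorners ℝ (EuclideanSpace ℝ (Fin m)) H}
  {M : Type*} [TopologicalSpace M] [ChartedSpace H M]

theorem measurableSet_extChartAt_target (c : M) : MeasurableSet (extChartAt I c).target := by
  rw [extChartAt_target]
  exact ((chartAt H c).open_target.preimage I.continuous_symm).measurableSet.inter
    I.isClosed_range.measurableSet

theorem aemeasurable_chart_density [IsManifold I ∞ M] [T2Space M] [CompactSpace M]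
    {D : ∀ x : M, (Fin m → TangentSpace I x) → ℝ}
    (hD : ∀ c : M, ContinuousOn (fun x => D x (coordFrame I c x)) (chartAt H c).source) (c : M) :
    AEMeasurable (fun y => ENNReal.ofReal (chartPartition I M c ((extChartAt I c).symm y)) *
        ENNReal.ofReal (D ((extChartAt I c).symm y) (coordFrame I c ((extChartAt I c).symm y))))
      (volume.restrict (extChartAt I c).target) := by
  have hρ : ContinuousOn (fun y => chartPartition I M c ((extChartAt I c).symm y))
      (extChartAt I c).target :=
    (chartPartition I M c).contMDiff.continuous.comp_continuousOn (continuousOn_extChartAt_symm c)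
  have hD' : ContinuousOn (fun y => D ((extChartAt I c).symm y)
      (coordFrame I c ((extChartAt I c).symm y))) (extChartAt I c).target :=
    (hD c).comp (continuousOn_extChartAt_symm c) fun y hy => by
      rw [← extChartAt_source I c]
      exact (extChartAt I c).map_target hy
  exact (hρ.aemeasurable (measurableSet_extChartAt_target c)).ennreal_ofReal.mul
    (hD'.aemeasurable (measurableSet_extChartAt_target c)).ennreal_ofReal

variable [MeasurableSpace M] [BorelSpace M]

theorem aemeasurable_extChartAt_symm (c : M) :
    AEMeasurable (extChartAt I c).symm (volume.restrict (extChartAt I c).target) :=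
  (continuousOn_extChartAt_symm c).aemeasurable (measurableSet_extChartAt_target c)

variable [IsManifold I ∞ M] [T2Space M] [CompactSpace M]
  {D D' : ∀ x : M, (Fin m → TangentSpace I x) → ℝ}

theorem lintegral_densityMeasure
    (hD : ∀ c : M, ContinuousOn (fun x => D x (coordFrame I c x)) (chartAt H c).source)
    {f : M → ℝ≥0∞} (hf : Measurable f) :
    ∫⁻ x, f x ∂(densityMeasure D) =
      ∑' c : M, ∫⁻ y in (extChartAt I c).target,
        ENNReal.ofReal (chartPartition I M c ((extChartAt I c).symm y)) *
        ENNReal.ofReal (D ((extChartAt I c).symm y) (coordFrame I c ((extChartAt I c).symm y))) *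
        f ((extChartAt I c).symm y) := by
  rw [densityMeasure, lintegral_sum_measure]
  refine tsum_congr fun c => ?_
  have h1 := aemeasurable_chart_density hD c
  have h2 := aemeasurable_extChartAt_symm (I := I) c
  rw [lintegral_map' hf.aemeasurable (h2.mono_ac (withDensity_absolutelyContinuous _ _))]
  exact lintegral_withDensity_eq_lintegral_mul₀ h1 (hf.comp_aemeasurable h2)

/-- Change of density: the quotient of two densities can be moved into the integrand. -/
theorem lintegral_densityMeasure_congr
    (hD : ∀ c : M, ContinuousOn (fun x => D x (coordFrame I c x)) (chartAt H c).source)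
    (hD' : ∀ c : M, ContinuousOn (fun x => D' x (coordFrame I c x)) (chartAt H c).source)
    {f g : M → ℝ≥0∞} (hf : Measurable f) (hg : Measurable g)
    (h : ∀ c, ∀ x ∈ (chartAt H c).source, ENNReal.ofReal (D x (coordFrame I c x)) * f x =
      ENNReal.ofReal (D' x (coordFrame I c x)) * g x) :
    ∫⁻ x, f x ∂(densityMeasure D) = ∫⁻ x, g x ∂(densityMeasure D') := by
  rw [lintegral_densityMeasure hD hf, lintegral_densityMeasure hD' hg]
  refine tsum_congr fun c => setLIntegral_congr_fun (measurableSet_extChartAt_target c)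
    fun y hy => ?_
  have hy' : (extChartAt I c).symm y ∈ (chartAt H c).source := by
    rw [← extChartAt_source I c]
    exact (extChartAt I c).map_target hy
  simp only [mul_assoc, h c _ hy']

/-- Finiteness holds since only finitely many functions of the partition of unity are nonzero on
the compact `M`, and each of them has compact support in the domain of its chart. -/
theorem isFiniteMeasure_densityMeasure
    (hD : ∀ c : M, ContinuousOn (fun x => D x (coordFrame I c x)) (chartAt H c).source) :
    IsFiniteMeasure (densityMeasure D) := by
  refine ⟨?_⟩
  rw [← lintegral_one, lintegral_densityMeasure hD measurable_const]
  simp only [mul_one]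
  have hfin : {c : M | (Function.support (chartPartition I M c)).Nonempty}.Finite :=
    (chartPartition I M).locallyFinite.finite_nonempty_of_compact
  rw [tsum_eq_sum (s := hfin.toFinset)]
  · refine ENNReal.sum_lt_top.2 fun c _ => ?_
    have hKs : tsupport (chartPartition I M c) ⊆ (chartAt H c).source :=
      chartPartition_isSubordinate I M c
    have hK : IsCompact (tsupport (chartPartition I M c)) := (isClosed_tsupport _).isCompact
    obtain ⟨B, hB⟩ := hK.bddAbove_image ((hD c).mono hKs)
    have hK' : IsCompact (extChartAt I c '' tsupport (chartPartition I M c)) :=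
      hK.image_of_continuousOn ((continuousOn_extChartAt c).mono (by rwa [extChartAt_source]))
    calc _ ≤ ∫⁻ y in (extChartAt I c).target,
          (extChartAt I c '' tsupport (chartPartition I M c)).indicator
            (fun _ => ENNReal.ofReal B) y := by
          refine setLIntegral_mono' (measurableSet_extChartAt_target c) fun y hy => ?_
          by_cases hx : (extChartAt I c).symm y ∈ tsupport (chartPartition I M c)
          · have hyK : y ∈ extChartAt I c '' tsupport (chartPartition I M c) :=
              ⟨_, hx, (extChartAt I c).right_inv hy⟩
            rw [indicator_of_mem hyK]
            calc _ ≤ 1 * ENNReal.ofReal B := by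
                  gcongr
                  · exact ENNReal.ofReal_le_one.2 ((chartPartition I M).le_one _ _)
                  · exact hB ⟨_, hx, rfl⟩
              _ = _ := one_mul _
          · rw [image_eq_zero_of_notMem_tsupport hx]
            simp
      _ ≤ ∫⁻ y, (extChartAt I c '' tsupport (chartPartition I M c)).indicator
            (fun _ => ENNReal.ofReal B) y := setLIntegral_le_lintegral _ _
      _ = ENNReal.ofReal B * volume (extChartAt I c '' tsupport (chartPartition I M c)) :=
          lintegral_indicator_const hK'.measurableSet _
      _ < ⊤ := ENNReal.mul_lt_top ENNReal.ofReal_lt_top hK'.measure_lt_top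
  · intro c hc
    have hz : ∀ x, chartPartition I M c x = 0 := fun x => by
      by_contra hx
      exact hc (hfin.mem_toFinset.2 ⟨x, hx⟩)
    simp [hz]

/-- A neighbourhood of a point of the model space within the range of the model with corners has
positive Lebesgue measure, since the interior of the range is dense in it. -/
theorem volume_pos_of_mem_nhdsWithin_range {y : EuclideanSpace ℝ (Fin m)} (hy : y ∈ range I)
    {W : Set (EuclideanSpace ℝ (Fin m))} (hW : W ∈ 𝓝[range I] y) : 0 < volume W := by
  obtain ⟨O, hO, hyO, hOW⟩ := mem_nhdsWithin.1 hW
  obtain ⟨z, hz⟩ := mem_closure_iff.1 (I.range_subset_closure_interior hy) O hO hyO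
  exact ((hO.inter isOpen_interior).measure_pos volume ⟨z, hz⟩).trans_le
    (measure_mono fun p hp => hOW ⟨hp.1, interior_subset hp.2⟩)

theorem isOpenPosMeasure_densityMeasure
    (hD : ∀ c : M, ContinuousOn (fun x => D x (coordFrame I c x)) (chartAt H c).source)
    (hpos : ∀ c, ∀ x ∈ (chartAt H c).source, 0 < D x (coordFrame I c x)) :
    (densityMeasure D).IsOpenPosMeasure := by
  refine ⟨fun U hU ⟨x, hxU⟩ h0 => ?_⟩
  obtain ⟨c, hc⟩ : ∃ c, 0 < chartPartition I M c x :=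
    (chartPartition I M).exists_pos_of_mem (mem_univ x)
  have hsupp : Function.support (chartPartition I M c) ⊆ (chartAt H c).source :=
    (subset_tsupport _).trans (chartPartition_isSubordinate I M c)
  have hxc : x ∈ (extChartAt I c).source := by
    rw [extChartAt_source]
    exact hsupp hc.ne'
  have h1 := (Measure.le_sum _ c U).trans_eq h0
  rw [nonpos_iff_eq_zero, Measure.map_apply_of_aemeasurable
    ((aemeasurable_extChartAt_symm c).mono_ac (withDensity_absolutelyContinuous _ _))
    hU.measurableSet, withDensity_apply_eq_zero' (aemeasurable_chart_density hD c),
    Measure.restrict_apply' (measurableSet_extChartAt_target c)] at h1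
  refine (volume_pos_of_mem_nhdsWithin_range (I := I) (y := extChartAt I c x)
    (extChartAt_target_subset_range c ((extChartAt I c).map_source hxc)) ?_).ne' h1
  have hcont : ContinuousAt (extChartAt I c).symm (extChartAt I c x) :=
    continuousAt_extChartAt_symm' hxc
  have hO : IsOpen (U ∩ Function.support (chartPartition I M c)) :=
    hU.inter (chartPartition I M c).contMDiff.continuous.isOpen_support
  have hmem := hcont.preimage_mem_nhds (hO.mem_nhds (by
    rw [(extChartAt I c).left_inv hxc]
    exact ⟨hxU, hc.ne'⟩))
  filter_upwards [mem_nhdsWithin_of_mem_nhds hmem, extChartAt_target_mem_nhdsWithin' hxc]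
    with y hy hyt
  refine ⟨⟨?_, hy.1⟩, hyt⟩
  refine mul_ne_zero (ENNReal.ofReal_pos.2 ?_).ne' (ENNReal.ofReal_pos.2 (hpos c _ ?_)).ne'
  · exact lt_of_le_of_ne ((chartPartition I M).nonneg _ _) (Ne.symm hy.2)
  · exact hsupp hy.2

end Densities

/-! ### The Ebin metric as an integral against a volume form -/

theorem sq_ofReal_sqrt (r : ℝ) : ENNReal.ofReal (√r) ^ 2 = ENNReal.ofReal r := by
  rw [← ENNReal.ofReal_pow (Real.sqrt_nonneg _)]
  rcases le_total 0 r with h | h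
  · rw [Real.sq_sqrt h]
  · rw [Real.sqrt_eq_zero_of_nonpos h, ENNReal.ofReal_of_nonpos h]
    simp

theorem rpow_half_sq (r : ℝ≥0∞) : (r ^ (1 / 2 : ℝ)) ^ 2 = r := by
  rw [← ENNReal.rpow_natCast, ← ENNReal.rpow_mul]
  simp

section EbinMetric

variable {m n : ℕ} {H : Type*} [TopologicalSpace H]
  {I : ModelWithCorners ℝ (EuclideanSpace ℝ (Fin m)) H}
  {M : Type*} [TopologicalSpace M] [ChartedSpace H M] [IsManifold I ∞ M]

theorem VolumeForm.abs_pos (μ : VolumeForm I M) {x : M}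
    (e : Module.Basis (Fin m) ℝ (TangentSpace I x)) : 0 < |μ.toFun x e| :=
  _root_.abs_pos.2 fun h => μ.ne_zero' x <| by
    have h' := (AlternatingMap.map_basis_eq_zero_iff e (μ.toFun x).toAlternatingMap).1 h
    ext v
    exact congrArg (fun f => f v) h'

theorem VolumeForm.continuousOn_abs (μ : VolumeForm I M) (c : M) :
    ContinuousOn (fun x => |μ.toFun x (coordFrame I c x)|) (chartAt H c).source :=
  (μ.smooth' c).continuousOn.abs

/-- The density with respect to `μ` of the integrand `tr (ζ (αᵀα)⁻¹ ηᵀ) vol(α)` of the Ebin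
metric. It does not depend on the basis of the tangent space, see
`metricDensity_eq_of_basis`. -/
def metricDensity (μ : VolumeForm I M) (α ζ η : OneForm I M n) (x : M) : ℝ :=
  matrixMetric (frameMatrix (α x) (coordFrame I x x)) (frameMatrix (ζ x) (coordFrame I x x))
    (frameMatrix (η x) (coordFrame I x x)) / |μ.toFun x (coordFrame I x x)|

theorem metricDensity_eq_of_basis (μ : VolumeForm I M) (α ζ η : OneForm I M n) {x : M}
    (e : Module.Basis (Fin m) ℝ (TangentSpace I x)) :
    metricDensity μ α ζ η x =
      matrixMetric (frameMatrix (α x) e) (frameMatrix (ζ x) e) (frameMatrix (η x) e) /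
        |μ.toFun x e| := by
  rw [metricDensity, ← coe_coordBasis (mem_chart_source H x)]
  set b := coordBasis (I := I) (mem_chart_source H x)
  have hdet : |(e.toMatrix b).det| ≠ 0 :=
    (abs_ne_zero.2 ((Matrix.isUnit_iff_isUnit_det _).1 (isUnit_toMatrix e b)).ne_zero)
  rw [frameMatrix_change (α x) e b, frameMatrix_change (ζ x) e b, frameMatrix_change (η x) e b,
    matrixMetric_mul_right _ _ _ (isUnit_toMatrix e b), alternating_change (μ.toFun x) e b,
    abs_mul, mul_comm |(e.toMatrix b).det|, mul_div_mul_right _ _ hdet]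

theorem traceForm_eq_of_basis (α ζ η : OneForm I M n) {x : M}
    (e e' : Module.Basis (Fin m) ℝ (TangentSpace I x)) :
    traceForm (frameMatrix (α x) e) (frameMatrix (ζ x) e) (frameMatrix (η x) e) =
      traceForm (frameMatrix (α x) e') (frameMatrix (ζ x) e') (frameMatrix (η x) e') := by
  rw [frameMatrix_change (α x) e e', frameMatrix_change (ζ x) e e', frameMatrix_change (η x) e e',
    traceForm_mul_right _ _ _ (isUnit_toMatrix e e')]

theorem frameMatrix_coordFrame_mem {α : OneForm I M n} (hα : α ∈ fullRankOneForms I M n)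
    {c x : M} (hx : x ∈ (chartAt H c).source) :
    frameMatrix (α x) (coordFrame I c x) ∈ fullRankMatrices n m := by
  rw [← coe_coordBasis hx]
  exact frameMatrix_mem_fullRankMatrices hα _

theorem continuous_metricDensity (μ : VolumeForm I M) {α : OneForm I M n}
    (hα : α ∈ fullRankOneForms I M n) (ζ η : OneForm I M n) :
    Continuous (metricDensity μ α ζ η) := by
  refine continuous_iff_continuousAt.2 fun c => ?_
  refine ContinuousOn.continuousAt ?_ (chart_source_mem_nhds H c)
  refine ContinuousOn.congr ((continuousOn_matrixMetric (continuousOn_frameMatrix α c)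
    (continuousOn_frameMatrix ζ c) (continuousOn_frameMatrix η c)
    fun x hx => frameMatrix_coordFrame_mem hα hx).div (μ.continuousOn_abs c) fun x hx => ?_)
    fun x hx => ?_
  · rw [← coe_coordBasis hx]
    exact (μ.abs_pos _).ne'
  · rw [metricDensity_eq_of_basis μ α ζ η (coordBasis hx), coe_coordBasis hx]
    rfl

theorem continuous_traceForm {α : OneForm I M n} (hα : α ∈ fullRankOneForms I M n)
    (ζ η : OneForm I M n) :
    Continuous fun x => traceForm (frameMatrix (α x) (coordFrame I x x))
      (frameMatrix (ζ x) (coordFrame I x x)) (frameMatrix (η x) (coordFrame I x x)) := by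
  refine continuous_iff_continuousAt.2 fun c => ?_
  refine ContinuousOn.continuousAt ?_ (chart_source_mem_nhds H c)
  refine ContinuousOn.congr (continuousOn_traceForm (continuousOn_frameMatrix α c)
    (continuousOn_frameMatrix ζ c) (continuousOn_frameMatrix η c)
    fun x hx => frameMatrix_coordFrame_mem hα hx) fun x hx => ?_
  simp only [← coe_coordBasis hx, ← coe_coordBasis (mem_chart_source H x)]
  exact traceForm_eq_of_basis α ζ η _ _

theorem continuousOn_oneForm_density (α : OneForm I M n) (c : M) :
    ContinuousOn (fun x => √(((frameMatrix (α x) (coordFrame I c x))ᵀ *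
      frameMatrix (α x) (coordFrame I c x)).det)) (chartAt H c).source :=
  continuousOn_sqrt_det_gram (continuousOn_frameMatrix α c)

theorem ofReal_sqrt_metricDensity (μ : VolumeForm I M) (α ζ : OneForm I M n) {x : M}
    (e : Module.Basis (Fin m) ℝ (TangentSpace I x)) :
    ENNReal.ofReal (√(metricDensity μ α ζ ζ x)) =
      ENNReal.ofReal (√(matrixMetric (frameMatrix (α x) e) (frameMatrix (ζ x) e)
        (frameMatrix (ζ x) e))) * ENNReal.ofReal (√(|μ.toFun x e|⁻¹)) := by
  rw [metricDensity_eq_of_basis μ α ζ ζ e, div_eq_mul_inv,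
    Real.sqrt_mul' _ (inv_nonneg.2 (abs_nonneg _)), ENNReal.ofReal_mul (Real.sqrt_nonneg _)]

theorem continuousOn_frameMatrix_curve {γ γ' : ℝ → OneForm I M n} (hγ : IsPiecewiseC1 γ γ')
    {x : M} (e : Module.Basis (Fin m) ℝ (TangentSpace I x)) :
    ContinuousOn (fun s => frameMatrix (γ s x) e) (Icc 0 1) :=
  continuousOn_pi.2 fun i => continuousOn_pi.2 fun j =>
    (hγ.map (matrixEntry i j ∘ₗ frameMatrixMap n e)
      ((continuous_id.matrix_elem i j).comp (continuous_frameMatrixMap n e))).continuousOn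

variable [T2Space M] [CompactSpace M] [MeasurableSpace M]

theorem ebinDist_self {α : OneForm I M n} (hα : α ∈ fullRankOneForms I M n) :
    ebinDist α α = 0 :=
  geodesicDist_self hα <| by
    have h : ∀ x, traceForm (frameMatrix (α x) (coordFrame I x x))
        (frameMatrix ((0 : OneForm I M n) x) (coordFrame I x x))
        (frameMatrix ((0 : OneForm I M n) x) (coordFrame I x x)) = 0 := fun x => by
      rw [show frameMatrix ((0 : OneForm I M n) x) (coordFrame I x x) = 0 from rfl]
      simp [traceForm]
    simp only [ebinMetric, h, integral_zero]

variable [BorelSpace M]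

instance (μ : VolumeForm I M) : IsFiniteMeasure μ.measure :=
  isFiniteMeasure_densityMeasure μ.continuousOn_abs

instance (μ : VolumeForm I M) : μ.measure.IsOpenPosMeasure :=
  isOpenPosMeasure_densityMeasure μ.continuousOn_abs fun c x hx => by
    rw [← coe_coordBasis hx]
    exact μ.abs_pos _

instance (α : OneForm I M n) : IsFiniteMeasure (oneFormVolume α) :=
  isFiniteMeasure_densityMeasure (continuousOn_oneForm_density α)

/-- The Ebin metric is the integral of its density with respect to `μ`. Compactness of `M` makes
the integrand integrable, so that the Bochner integral has no junk value. -/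
theorem ofReal_ebinMetric (μ : VolumeForm I M) {α : OneForm I M n}
    (hα : α ∈ fullRankOneForms I M n) (ζ : OneForm I M n) :
    ENNReal.ofReal (ebinMetric α ζ ζ) =
      ∫⁻ x, ENNReal.ofReal (metricDensity μ α ζ ζ x) ∂μ.measure := by
  have hcont := continuous_traceForm hα ζ ζ
  have hnonneg : ∀ x, 0 ≤ traceForm (frameMatrix (α x) (coordFrame I x x))
      (frameMatrix (ζ x) (coordFrame I x x)) (frameMatrix (ζ x) (coordFrame I x x)) := fun x =>
    traceForm_self_nonneg (frameMatrix_coordFrame_mem hα (mem_chart_source H x)) _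
  rw [ebinMetric, ofReal_integral_eq_lintegral_ofReal
    (hcont.integrable_of_hasCompactSupport (HasCompactSupport.of_compactSpace _))
    (ae_of_all _ hnonneg)]
  refine lintegral_densityMeasure_congr (continuousOn_oneForm_density α) μ.continuousOn_abs
    hcont.measurable.ennreal_ofReal (continuous_metricDensity μ hα ζ ζ).measurable.ennreal_ofReal
    fun c x hx => ?_
  simp only [metricDensity_eq_of_basis μ α ζ ζ (coordBasis hx), ← coe_coordBasis hx,
    ← coe_coordBasis (mem_chart_source H x)]
  rw [traceForm_eq_of_basis α ζ ζ _ (coordBasis hx), ← ENNReal.ofReal_mul (Real.sqrt_nonneg _),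
    ← ENNReal.ofReal_mul (abs_nonneg _), mul_div_cancel₀ _ (μ.abs_pos _).ne', matrixMetric,
    mul_comm]

/-! ### Comparison of the distances -/

theorem aemeasurable_metricDensity_curve (μ : VolumeForm I M) {γ γ' : ℝ → OneForm I M n}
    (hγ : IsPiecewiseC1 γ γ') (hU : ∀ s ∈ Icc (0 : ℝ) 1, γ s ∈ fullRankOneForms I M n) :
    AEMeasurable (Function.uncurry fun s => metricDensity μ (γ s) (γ' s) (γ' s))
      ((volume.restrict (Icc (0 : ℝ) 1)).prod μ.measure) := by
  obtain ⟨k, t, ht, h0, hk, hpiece⟩ := id hγ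
  refine aemeasurable_uncurry_of_pieces μ.measure ht h0 hk fun i hi => ?_
  obtain ⟨g, hg, -, heq⟩ := hpiece i hi
  have hsub : Icc (t i) (t (i + 1)) ⊆ Icc 0 1 :=
    Icc_subset_Icc (h0 ▸ ht (Nat.zero_le i)) (hk ▸ ht hi)
  refine ⟨fun s => metricDensity μ (γ s) (g s) (g s), fun x => ?_, fun s hs =>
    (continuous_metricDensity μ (hU s (hsub hs)) _ _).measurable, fun s hs => ?_⟩
  · have hgx : ContinuousOn (fun s => frameMatrix (g s x)
        (coordBasis (I := I) (mem_chart_source H x))) (Icc (t i) (t (i + 1))) :=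
      (continuous_frameMatrixMap n (coordBasis (I := I) (mem_chart_source H x))).comp_continuousOn hg
    simp only [metricDensity_eq_of_basis μ _ _ _ (coordBasis (mem_chart_source H x))]
    exact (continuousOn_matrixMetric ((continuousOn_frameMatrix_curve hγ _).mono hsub) hgx hgx
      fun s hs => frameMatrix_mem_fullRankMatrices (hU s (hsub hs)) _).div_const _
  · rw [heq hs]

/-- At each point of `M`, a curve of one-forms gives a curve of matrices, of length at least the
distance of its end points. Integrating the squares of these lengths and applying Minkowski's
inequality gives the comparison. The frames `e` need not have unit volume, which is compensated by
the factor `|μ(e)|⁻¹`. -/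
theorem lintegral_matrixDist_sq_le (μ : VolumeForm I M)
    (e : ∀ x : M, Module.Basis (Fin m) ℝ (TangentSpace I x)) (α β : OneForm I M n) :
    ∫⁻ x, matrixDist (frameMatrix (α x) (e x)) (frameMatrix (β x) (e x)) ^ 2 *
        ENNReal.ofReal (|μ.toFun x (e x)|⁻¹) ∂μ.measure ≤ ebinDist α β ^ 2 := by
  rw [← rpow_half_sq (∫⁻ x, _ ∂μ.measure)]
  gcongr
  refine le_iInf₂ fun γ γ' => le_iInf₂ fun hγ hU => le_iInf₂ fun h0 h1 => ?_
  let f : ℝ → M → ℝ≥0∞ := fun s x => ENNReal.ofReal (√(metricDensity μ (γ s) (γ' s) (γ' s) x))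
  have hf : AEMeasurable (Function.uncurry f)
      ((volume.restrict (Icc (0 : ℝ) 1)).prod μ.measure) :=
    (aemeasurable_metricDensity_curve μ hγ hU).sqrt.ennreal_ofReal
  have hpoint : ∀ x, matrixDist (frameMatrix (α x) (e x)) (frameMatrix (β x) (e x)) ^ 2 *
      ENNReal.ofReal (|μ.toFun x (e x)|⁻¹) ≤ (∫⁻ s in Icc (0 : ℝ) 1, f s x) ^ 2 := fun x => by
    have hle : matrixDist (frameMatrix (α x) (e x)) (frameMatrix (β x) (e x)) ≤
        ∫⁻ s in Icc (0 : ℝ) 1, ENNReal.ofReal (√(matrixMetric (frameMatrix (γ s x) (e x))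
          (frameMatrix (γ' s x) (e x)) (frameMatrix (γ' s x) (e x)))) :=
      geodesicDist_le (hγ.map (frameMatrixMap n (e x)) (continuous_frameMatrixMap n (e x)))
        (fun s hs => frameMatrix_mem_fullRankMatrices (hU s hs) _)
        (by rw [h0]) (by rw [h1])
    simp only [f, ofReal_sqrt_metricDensity μ _ _ (e x)]
    rw [lintegral_mul_const' _ _ ENNReal.ofReal_ne_top, mul_pow, sq_ofReal_sqrt]
    gcongr
  have hspeed : ∀ s ∈ Icc (0 : ℝ) 1, (∫⁻ x, f s x ^ 2 ∂μ.measure) ^ (1 / 2 : ℝ) =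
      ENNReal.ofReal (√(ebinMetric (γ s) (γ' s) (γ' s))) := fun s hs => by
    simp only [f, sq_ofReal_sqrt]
    rw [← ofReal_ebinMetric μ (hU s hs), ← sq_ofReal_sqrt, ← ENNReal.rpow_natCast,
      ← ENNReal.rpow_mul]
    simp
  calc (∫⁻ x, _ ∂μ.measure) ^ (1 / 2 : ℝ)
      ≤ (∫⁻ x, (∫⁻ s in Icc (0 : ℝ) 1, f s x) ^ 2 ∂μ.measure) ^ (1 / 2 : ℝ) := by
        gcongr with x
        exact hpoint x
    _ ≤ ((∫⁻ s in Icc (0 : ℝ) 1, (∫⁻ x, f s x ^ 2 ∂μ.measure) ^ (1 / 2 : ℝ)) ^ 2) ^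
          (1 / 2 : ℝ) := by
        gcongr
        exact sq_lintegral_le _ _ hf
    _ = ∫⁻ s in Icc (0 : ℝ) 1, (∫⁻ x, f s x ^ 2 ∂μ.measure) ^ (1 / 2 : ℝ) := by
        rw [← ENNReal.rpow_natCast, ← ENNReal.rpow_mul]
        simp
    _ = _ := setLIntegral_congr_fun measurableSet_Icc hspeed

/-- If `α` and `β` differ at a point, then in the coordinate frames of a chart around it the
distance of their matrices is bounded below on a neighbourhood, which has positive measure. A lower
bound on an open set is needed since vanishing of the lower Lebesgue integral `∫⁻` only implies
vanishing almost everywhere for measurable functions, and the frames vary with the point. -/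
theorem eq_of_ebinDist_eq_zero (μ : VolumeForm I M) {α β : OneForm I M n}
    (hα : α ∈ fullRankOneForms I M n) (h : ebinDist α β = 0) : α = β := by
  classical
  by_contra hne
  obtain ⟨c, hc⟩ : ∃ c, α c ≠ β c := by
    by_contra! h'
    exact hne (ContMDiffSection.ext h')
  have hcs : c ∈ (chartAt H c).source := mem_chart_source H c
  let A : M → Matrix (Fin n) (Fin m) ℝ := fun x => frameMatrix (α x) (coordFrame I c x)
  let B : M → Matrix (Fin n) (Fin m) ℝ := fun x => frameMatrix (β x) (coordFrame I c x)
  obtain ⟨i, j, hij⟩ : ∃ i j, A c i j ≠ B c i j := by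
    by_contra! h'
    refine hc (eq_of_frameMatrix_eq (e := coordBasis (I := I) hcs) ?_)
    rw [coe_coordBasis]
    exact Matrix.ext h'
  have hAc : ContinuousAt A c :=
    (continuousOn_frameMatrix α c).continuousAt (chart_source_mem_nhds H c)
  have hBc : ContinuousAt B c :=
    (continuousOn_frameMatrix β c).continuousAt (chart_source_mem_nhds H c)
  have hentry : ∀ {C : M → Matrix (Fin n) (Fin m) ℝ}, ContinuousAt C c → ∀ i j,
      ContinuousAt (fun x => C x i j) c := fun hC i j =>
    continuousAt_pi.1 (continuousAt_pi.1 hC i) j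
  obtain ⟨r, hr, κ, hκ, hle⟩ := exists_le_matrixDist (frameMatrix_coordFrame_mem hα hcs)
  set d := |B c i j - A c i j|
  have hd0 : 0 < d := abs_pos.2 (sub_ne_zero.2 hij.symm)
  have hμc : ContinuousAt (fun x => |μ.toFun x (coordFrame I c x)|) c :=
    (μ.continuousOn_abs c).continuousAt (chart_source_mem_nhds H c)
  have e1 : ∀ᶠ x in 𝓝 c, ∀ i j, |A x i j - A c i j| ≤ r := by
    refine eventually_all.2 fun i => eventually_all.2 fun j => ?_
    have := ((hentry hAc i j).sub (continuousAt_const (y := A c i j))).abs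
    exact (this.eventually_lt continuousAt_const (by simpa using hr)).mono fun _ h => h.le
  have e2 : ∀ᶠ x in 𝓝 c, d / 2 ≤ |B x i j - A x i j| :=
    (continuousAt_const.eventually_lt ((hentry hBc i j).sub (hentry hAc i j)).abs
      (half_lt_self hd0)).mono fun _ h => h.le
  have e3 : ∀ᶠ x in 𝓝 c, |μ.toFun x (coordFrame I c x)| ≤ |μ.toFun c (coordFrame I c c)| + 1 :=
    (hμc.eventually_lt continuousAt_const (lt_add_one _)).mono fun _ h => h.le
  obtain ⟨U, hUsub, hUo, hcU⟩ := mem_nhds_iff.1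
    (((e1.and e2).and e3).and (chart_source_mem_nhds H c))
  -- The frame of the chart around `c` where it is defined, and an arbitrary frame elsewhere.
  let e : ∀ x : M, Module.Basis (Fin m) ℝ (TangentSpace I x) := fun x =>
    if hx : x ∈ (chartAt H c).source then coordBasis hx else coordBasis (mem_chart_source H x)
  have he : ∀ x ∈ (chartAt H c).source, ⇑(e x) = coordFrame I c x := fun x hx => by
    simp only [e, dif_pos hx, coe_coordBasis]
  set δ : ℝ≥0∞ := ENNReal.ofReal (κ * min r (d / 2)) ^ 2 *
    ENNReal.ofReal ((|μ.toFun c (coordFrame I c c)| + 1)⁻¹) with hδ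
  have hδ0 : δ ≠ 0 := by
    refine mul_ne_zero (pow_ne_zero _ ?_) ?_
    · exact (ENNReal.ofReal_pos.2 (mul_pos hκ (lt_min hr (half_pos hd0)))).ne'
    · exact (ENNReal.ofReal_pos.2 (by positivity)).ne'
  have hbound : δ * μ.measure U ≤ ebinDist α β ^ 2 := by
    refine le_trans ?_ (lintegral_matrixDist_sq_le μ e α β)
    rw [← setLIntegral_const]
    refine (setLIntegral_mono' hUo.measurableSet fun x hx => ?_).trans
      (setLIntegral_le_lintegral U _)
    obtain ⟨⟨⟨h1, h2⟩, h3⟩, hxs⟩ := hUsub hx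
    rw [he x hxs]
    have hpos : 0 < |μ.toFun x (coordFrame I c x)| := by
      rw [← coe_coordBasis hxs]
      exact μ.abs_pos _
    rw [hδ]
    gcongr
    refine le_trans (ENNReal.ofReal_le_ofReal ?_) (hle _ _ h1 i j)
    gcongr
  rw [h, zero_pow two_ne_zero, nonpos_iff_eq_zero] at hbound
  exact mul_ne_zero hδ0 (hUo.measure_pos μ.measure ⟨c, hcU⟩).ne' hbound

end EbinMetric

end GeneralizedEbin

end

theorem mainTheorem2 {m n : ℕ} (hmn : m ≤ n)
    {H : Type*} [TopologicalSpace H]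
    (I : ModelWithCorners ℝ (EuclideanSpace ℝ (Fin m)) H)
    (M : Type*) [TopologicalSpace M] [ChartedSpace H M] [IsManifold I ∞ M]
    [T2Space M] [CompactSpace M] [MeasurableSpace M] [BorelSpace M]
    (μ : GeneralizedEbin.VolumeForm I M) :
    (∀ α ∈ GeneralizedEbin.fullRankOneForms I M n,
      ∀ β ∈ GeneralizedEbin.fullRankOneForms I M n,
        GeneralizedEbin.ebinDist α β = 0 ↔ α = β) ∧
    (∀ e : ∀ x : M, Module.Basis (Fin m) ℝ (TangentSpace I x), (∀ x, |μ.toFun x (e x)| = 1) →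
      ∀ α ∈ GeneralizedEbin.fullRankOneForms I M n,
      ∀ β ∈ GeneralizedEbin.fullRankOneForms I M n,
        ∫⁻ x, GeneralizedEbin.matrixDist (GeneralizedEbin.frameMatrix (α x) (e x))
          (GeneralizedEbin.frameMatrix (β x) (e x)) ^ 2 ∂μ.measure
          ≤ GeneralizedEbin.ebinDist α β ^ 2) := by
  refine ⟨fun α hα β _ => ⟨GeneralizedEbin.eq_of_ebinDist_eq_zero μ hα, ?_⟩,
    fun e he α _ β _ => ?_⟩
  · rintro rfl
    exact GeneralizedEbin.ebinDist_self hα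
  · simpa [he] using GeneralizedEbin.lintegral_matrixDist_sq_le μ e α β
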